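/- Let $\mathcal H$ be a complex Hilbert space, $\{\mathcal H_i\}_{i\in I}$ a countable family of complex Hilbert spaces, and let $C,C'$ be bounded operators on $\mathcal H$ with bounded inverse that are positive, i.e. $\langle Cf,f\rangle>0$ and $\langle C'f,f\rangle>0$ for all $f\ne 0$. Let $\Lambda=\{\Lambda_i\}_{i\in I}$ and $\Theta=\{\Theta_i\}_{i\in I}$, with $\Lambda_i,\Theta_i:\mathcal H\to\mathcal H_i$ bounded linear operators, be $g$-Bessel sequences, i.e. $\sum_i\|\Lambda_if\|^2\le B\|f\|^2$ and $\sum_i\|\Theta_if\|^2\le B\|f\|^2$ for some $B<\infty$ and all $f\in\mathcal H$. Suppose that $\Lambda$ is $C'^2$-controlled and $\Theta$ is $C^2$-controlled, i.e. for some $B'<\infty$ and all $f\in\mathcal H$ $$\sum_{i}\langle\Lambda_iC'f,\Lambda_iC'f\rangle\le B'\|f\|^2,\qquad \sum_{i}\langle\Theta_iCf,\Theta_iCf\rangle\le B'\|f\|^2 .$$ For $0<p<\infty$, the Schatten $p$-class $\mathcal S_p$ consists of the compact operators whose singular values are $p$-summable, where the singular values of $T$ are the numbers $\lambda_n>0$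 in an expansion $Tx=\sum_n\lambda_n\langle x,e_n\rangle\sigma_n$ with orthonormal $(e_n)$ and $(\sigma_n)$. **Theorem.** Let $0<p<\infty$, $m=(m_i)_{i\in I}\in\ell^p$ (complex), and $\sup_i\dim\mathcal H_i<\infty$. Then the controlled multiplier $$\mathbf M_{mC\Theta\Lambda C'}f=\sum_{i\in I}m_i\,C\Theta_i^*\Lambda_iC'f\qquad(f\in\mathcal H)$$ is a well-defined bounded operator on $\mathcal H$ and belongs to $\mathcal S_p$. Moreover $\mathbf M_{mC\Theta\Lambda C'}=C\,T_\Theta D_mT_\Lambda^*\,C'$, where $T_\Theta,T_\Lambda:(\bigoplus_i\mathcal H_i)_{\ell_2}\to\mathcal H$ are the bounded synthesis operators $T_\Theta(\xi_i)=\sum_i\Theta_i^*\xi_i$, $T_\Lambda(\xi_i)=\sum_i\Lambda_i^*\xi_i$; the diagonal operator $D_m(\xi_i)=(m_i\xi_i)$ on $(\bigoplus_i\mathcal H_i)_{\ell_2}$ is bounded and belongs to the Schatten $p$-class; and the Schatten $p$-class of $\mathcal H$ is a two-sided ideal of the algebra of bounded operators on $\mathcal H$, closed under adjoints. -/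

import Mathlib

namespace ControlledGFrame

/-- `s, e, σ` (indexed by a set `N` of natural numbers) is a singular value decomposition of `T`:
`e` and `σ` are orthonormal, all `s n` are positive, and `T x = ∑ n, s n ⟨x, e n⟩ σ n`
(`inner ℂ` is linear in its second argument). The family `s` consists of the nonzero singular
values of `T`, repeated according to multiplicity. -/
structure IsSingularValueDecomposition {E F : Type*}
    [NormedAddCommGroup E] [InnerProductSpace ℂ E] [NormedAddCommGroup F] [InnerProductSpace ℂ F]
    (T : E →L[ℂ] F) (N : Set ℕ) (s : N → ℝ) (e : N → E) (σ : N → F) : Prop where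
  orthonormal_left : Orthonormal ℂ e
  orthonormal_right : Orthonormal ℂ σ
  pos : ∀ n, 0 < s n
  hasSum : ∀ x, HasSum (fun n => ((s n : ℂ) * inner ℂ (e n) x) • σ n) (T x)

/-- The Schatten `p`-class: compact operators whose singular values are `p`-summable. -/
def IsSchattenClass {E F : Type*}
    [NormedAddCommGroup E] [InnerProductSpace ℂ E] [NormedAddCommGroup F] [InnerProductSpace ℂ F]
    (p : ℝ) (T : E →L[ℂ] F) : Prop :=
  IsCompactOperator T ∧
    ∃ (N : Set ℕ) (s : N → ℝ) (e : N → E) (σ : N → F),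
      IsSingularValueDecomposition T N s e σ ∧ Summable (fun n => s n ^ p)

open scoped ComplexOrder in
/-- Bounded operators with bounded inverse that are positive: `⟨C f, f⟩ > 0` for all `f ≠ 0`
(in the order of `ℂ`, so that `⟨C f, f⟩` is in particular real). -/
def IsInvertiblePositive {E : Type*} [NormedAddCommGroup E] [InnerProductSpace ℂ E]
    (C : E →L[ℂ] E) : Prop :=
  IsUnit C ∧ ∀ f : E, f ≠ 0 → 0 < inner ℂ (C f) f

section Families

variable {ι : Type*} {H : Type*} [NormedAddCommGroup H] [InnerProductSpace ℂ H]
  {G : ι → Type*} [∀ i, NormedAddCommGroup (G i)] [∀ i, InnerProductSpace ℂ (G i)]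

/-- `g`-Bessel sequences: `∑ i, ‖Λ i f‖² ≤ B ‖f‖²` for all `f`. -/
def IsGBessel (Λ : ∀ i, H →L[ℂ] G i) : Prop :=
  ∃ B : ℝ, ∀ f : H, Summable (fun i => ‖Λ i f‖ ^ 2) ∧ ∑' i, ‖Λ i f‖ ^ 2 ≤ B * ‖f‖ ^ 2

/-- `(C, C')`-controlled `g`-Bessel sequences: `g`-Bessel sequences for which
`∑ i, ⟨Λ i (C f), Λ i (C' f)⟩` is real and at most `B ‖f‖²` for all `f`. -/
def IsControlledGBessel (C C' : H →L[ℂ] H) (Λ : ∀ i, H →L[ℂ] G i) : Prop :=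
  IsGBessel Λ ∧
    ∃ B : ℝ, ∀ f : H, ∃ t : ℝ,
      HasSum (fun i => inner ℂ (Λ i (C' f)) (Λ i (C f))) (t : ℂ) ∧ t ≤ B * ‖f‖ ^ 2

/-- `D` is the diagonal operator `(ξ i) ↦ (m i ξ i)` on the `ℓ²` direct sum. -/
def IsDiagonalOperator (m : ι → ℂ) (D : lp G 2 →L[ℂ] lp G 2) : Prop :=
  ∀ (ξ : lp G 2) (i : ι), D ξ i = m i • ξ i

variable [CompleteSpace H] [∀ i, CompleteSpace (G i)]

/-- `T` is the synthesis operator `(ξ i) ↦ ∑ i, (Λ i)* (ξ i)` of `Λ`. -/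
def IsSynthesisOperator (Λ : ∀ i, H →L[ℂ] G i) (T : lp G 2 →L[ℂ] H) : Prop :=
  ∀ ξ : lp G 2, HasSum (fun i => ContinuousLinearMap.adjoint (Λ i) (ξ i)) (T ξ)

/-- `M` is the `(C, C')`-controlled multiplier operator
`f ↦ ∑ i, m i C (Θ i)* (Λ i) C' f` with symbol `m`. -/
def IsControlledMultiplier (m : ι → ℂ) (C C' : H →L[ℂ] H) (Θ Λ : ∀ i, H →L[ℂ] G i)
    (M : H →L[ℂ] H) : Prop :=
  ∀ f : H, HasSum
    (fun i => m i • C (ContinuousLinearMap.adjoint (Θ i) (Λ i (C' f)))) (M f)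

end Families

end ControlledGFrame

namespace ControlledGFrame

open Filter Topology

/-! ### Dyadic counting of `p`-summable families -/

section Counting

variable {κ : Type*} {t : κ → ℝ} {p : ℝ}

/-! Singular values are awkward under sums and products, so the Schatten class is replaced by a rank
count: `T` lies within `2^{-j}` of an operator of rank at most `r j`, with `∑ r j 2^{-jp} < ∞`
(`IsDyadicallyApproximable`). Ranks add and survive composition and adjoints, while a bounded factor
only shifts `j`. This gives the ideal property for every `p > 0`, with no triangle inequality for a
Schatten norm, so `p < 1` needs no separate treatment.

The equivalence `isSchattenClass_iff` rests on two facts. A family is `p`-summable exactly when its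
level counts `#{k | 2^{-j} < t k}` are summable against `2^{-jp}` (for the converse: bounded, with
finite level sets). And an operator of rank at most `r` within `ε` of `T` leaves at most `r`
singular values above `ε` (`card_le_of_norm_sub_le`). The expansion itself comes from an eigenbasis
of `T* T`.

For the multiplier, truncating `D` to the blocks with `|m i| > 2^{-j}` costs rank at most `d` per
block, so `D` is in the class, and `M` is `D` between bounded operators. -/

lemma half_rpow_pos : 0 < ((1 / 2 : ℝ) ^ p) := by positivity

lemma half_rpow_lt_one (hp : 0 < p) : ((1 / 2 : ℝ) ^ p) < 1 :=
  Real.rpow_lt_one (by norm_num) (by norm_num) hp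

lemma half_pow_rpow (j : ℕ) : ((1 / 2 : ℝ) ^ j) ^ p = ((1 / 2 : ℝ) ^ p) ^ j := by
  rw [← Real.rpow_natCast, ← Real.rpow_mul (by norm_num), mul_comm,
    Real.rpow_mul (by norm_num), Real.rpow_natCast]

open Classical in
/-- The dyadic layers of a nonnegative family: `(k, j) ↦ 2^{-jp}` if `2^{-j} < t k`. -/
noncomputable def layer (p : ℝ) (t : κ → ℝ) (k : κ) (j : ℕ) : ℝ :=
  if (1 / 2 : ℝ) ^ j < t k then ((1 / 2 : ℝ) ^ p) ^ j else 0

lemma layer_nonneg (k : κ) (j : ℕ) : 0 ≤ layer p t k j := by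
  unfold layer
  split_ifs <;> positivity

lemma layer_le (k : κ) (j : ℕ) : layer p t k j ≤ ((1 / 2 : ℝ) ^ p) ^ j := by
  unfold layer
  split_ifs
  · exact le_rfl
  · positivity

lemma summable_layer_right (hp : 0 < p) (k : κ) : Summable (layer p t k) :=
  .of_nonneg_of_le (layer_nonneg k) (layer_le k)
    (summable_geometric_of_lt_one half_rpow_pos.le (half_rpow_lt_one hp))

/-- The first dyadic layer below a positive number. -/
lemma exists_first_layer {x : ℝ} (hx : 0 < x) :
    ∃ j : ℕ, (1 / 2 : ℝ) ^ j < x ∧ ∀ i < j, x ≤ (1 / 2 : ℝ) ^ i := by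
  classical
  have h : ∃ j : ℕ, (1 / 2 : ℝ) ^ j < x := exists_pow_lt_of_lt_one hx (by norm_num)
  exact ⟨Nat.find h, Nat.find_spec h, fun i hi => not_lt.1 (Nat.find_min h hi)⟩

/-- The nonzero layers start at the first `j` with `2^{-j} < t k`, and the geometric tail from there
has leading term `2^{-jp} ≤ t k ^ p`. -/
lemma tsum_layer_le (hp : 0 < p) (ht : ∀ k, 0 ≤ t k) (k : κ) :
    ∑' j, layer p t k j ≤ t k ^ p * (1 - (1 / 2 : ℝ) ^ p)⁻¹ := by
  have hq := half_rpow_lt_one hp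
  have hq' : 0 < 1 - (1 / 2 : ℝ) ^ p := by linarith
  rcases (ht k).eq_or_lt with h0 | h0
  · have : ∀ j, layer p t k j = 0 := fun j => by
      rw [layer, if_neg]
      rw [← h0, not_lt]
      positivity
    simp only [this, tsum_zero]
    exact mul_nonneg (Real.rpow_nonneg (ht k) _) (inv_nonneg.2 hq'.le)
  · obtain ⟨j, hj, hmin⟩ := exists_first_layer h0
    rw [← (summable_layer_right hp k).sum_add_tsum_nat_add j,
      Finset.sum_eq_zero, zero_add]
    · calc ∑' i, layer p t k (i + j)
          ≤ ∑' i : ℕ, ((1 / 2 : ℝ) ^ p) ^ j * ((1 / 2 : ℝ) ^ p) ^ i := by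
            refine Summable.tsum_le_tsum (fun i => ?_)
              ((summable_nat_add_iff j).2 (summable_layer_right hp k))
              ((summable_geometric_of_lt_one half_rpow_pos.le hq).mul_left _)
            rw [← pow_add, add_comm j]
            exact layer_le k _
        _ = ((1 / 2 : ℝ) ^ p) ^ j * (1 - (1 / 2 : ℝ) ^ p)⁻¹ := by
            rw [tsum_mul_left, tsum_geometric_of_lt_one half_rpow_pos.le hq]
        _ ≤ _ := by
            gcongr
            rw [← half_pow_rpow]
            exact Real.rpow_le_rpow (by positivity) hj.le hp.le
    · intro i hi
      rw [layer, if_neg (not_lt.2 (hmin i (Finset.mem_range.1 hi)))]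

lemma hasSum_layer_left {j : ℕ} (hfin : {k | (1 / 2 : ℝ) ^ j < t k}.Finite) :
    HasSum (fun k => layer p t k j)
      ({k | (1 / 2 : ℝ) ^ j < t k}.ncard * ((1 / 2 : ℝ) ^ p) ^ j) := by
  have h : HasSum (fun k => layer p t k j) (∑ k ∈ hfin.toFinset, layer p t k j) := by
    refine hasSum_sum_of_ne_finset_zero fun k hk => ?_
    rw [layer, if_neg]
    simpa using hk
  convert h using 1
  rw [Finset.sum_congr rfl (g := fun _ => ((1 / 2 : ℝ) ^ p) ^ j), Finset.sum_const, nsmul_eq_mul,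
    Set.ncard_eq_toFinset_card _ hfin]
  intro k hk
  rw [layer, if_pos]
  simpa using hk

lemma finite_layer_of_summable (hp : 0 < p)
    (hs : Summable fun k => t k ^ p) (j : ℕ) : {k | (1 / 2 : ℝ) ^ j < t k}.Finite := by
  have h := hs.tendsto_cofinite_zero.eventually
    (gt_mem_nhds (show (0 : ℝ) < ((1 / 2 : ℝ) ^ j) ^ p by positivity))
  refine Set.Finite.subset (Filter.eventually_cofinite.1 h) fun k hk => ?_
  simp only [Set.mem_ofPred_eq, not_lt] at hk ⊢
  exact Real.rpow_le_rpow (by positivity) hk.le hp.le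

/-- The level sets of a `p`-summable family satisfy `∑ j, #{k | 2^{-j} < t k} 2^{-jp} < ∞`. -/
lemma summable_ncard_layer (hp : 0 < p) (ht : ∀ k, 0 ≤ t k) (hs : Summable fun k => t k ^ p) :
    Summable fun j : ℕ => ({k | (1 / 2 : ℝ) ^ j < t k}.ncard : ℝ) * ((1 / 2 : ℝ) ^ p) ^ j := by
  have h1 : Summable (Function.uncurry (layer p t)) := by
    refine (summable_prod_of_nonneg fun x => layer_nonneg x.1 x.2).2
      ⟨summable_layer_right hp, ?_⟩
    exact .of_nonneg_of_le (fun k => tsum_nonneg (layer_nonneg k)) (tsum_layer_le hp ht)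
      (hs.mul_right _)
  have h2 := ((summable_prod_of_nonneg fun x => layer_nonneg x.2 x.1).1
    ((Equiv.prodComm ℕ κ).summable_iff.2 h1)).2
  refine h2.congr fun j => ?_
  exact (hasSum_layer_left (finite_layer_of_summable hp hs j)).tsum_eq

/-- A bounded family whose level sets satisfy `∑ j, #{k | 2^{-j} < t k} 2^{-jp} < ∞` is
`p`-summable. -/
lemma summable_rpow_of_summable_ncard_layer (hp : 0 < p) (ht : ∀ k, 0 ≤ t k) {c : ℝ}
    (hc : ∀ k, t k ≤ c) (hfin : ∀ j : ℕ, {k | (1 / 2 : ℝ) ^ j < t k}.Finite)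
    (hs : Summable fun j : ℕ =>
      ({k | (1 / 2 : ℝ) ^ j < t k}.ncard : ℝ) * ((1 / 2 : ℝ) ^ p) ^ j) :
    Summable fun k => t k ^ p := by
  have h1 : Summable (Function.uncurry fun j k => layer p t k j) := by
    refine (summable_prod_of_nonneg fun x => layer_nonneg x.2 x.1).2
      ⟨fun j => (hasSum_layer_left (hfin j)).summable, ?_⟩
    exact hs.congr fun j => (hasSum_layer_left (hfin j)).tsum_eq.symm
  have h2 := ((summable_prod_of_nonneg fun x => layer_nonneg x.1 x.2).1
    ((Equiv.prodComm κ ℕ).summable_iff.2 h1)).2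
  refine .of_nonneg_of_le (fun k => Real.rpow_nonneg (ht k) _) (fun k => ?_)
    (h2.mul_left (max (c ^ p) (2 ^ p)))
  change _ ≤ _ * ∑' j, layer p t k j
  rcases (ht k).eq_or_lt with h0 | h0
  · rw [← h0, Real.zero_rpow hp.ne']
    exact mul_nonneg (le_max_of_le_right (by positivity)) (tsum_nonneg (layer_nonneg k))
  obtain ⟨j, hj, hmin⟩ := exists_first_layer h0
  have hle : ((1 / 2 : ℝ) ^ p) ^ j ≤ ∑' j, layer p t k j := by
    refine le_trans (le_of_eq ?_)
      ((summable_layer_right hp k).le_tsum j fun i _ => layer_nonneg k i)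
    rw [layer, if_pos hj]
  refine le_trans ?_ (mul_le_mul_of_nonneg_left hle (le_max_of_le_right (by positivity)))
  -- In layer zero only the bound `c` is available. Later, minimality of `j = i + 1` gives `t k ≤
  -- 2^{-i} = 2 * 2^{-j}`, hence the constant `max (c ^ p) (2 ^ p)`.
  rcases j with _ | i
  · rw [pow_zero, mul_one]
    exact le_max_of_le_left (Real.rpow_le_rpow (ht k) (hc k) hp.le)
  · refine le_trans ?_ (mul_le_mul_of_nonneg_right (le_max_right _ _) (by positivity))
    rw [← half_pow_rpow, ← Real.mul_rpow (by norm_num) (by positivity)]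
    refine Real.rpow_le_rpow (ht k) ((hmin i (Nat.lt_succ_self i)).trans (le_of_eq ?_)) hp.le
    ring

end Counting

/-! ### Operators of finite rank -/

section FiniteRank

variable {E F K : Type*} [NormedAddCommGroup E] [InnerProductSpace ℂ E]
  [NormedAddCommGroup F] [InnerProductSpace ℂ F] [NormedAddCommGroup K] [InnerProductSpace ℂ K]

/-- `R` is a sum of at most `r` operators of the form `x ↦ ⟨u, x⟩ v`. -/
def IsRankLE (r : ℕ) (R : E →L[ℂ] F) : Prop :=
  ∃ n ≤ r, ∃ (u : Fin n → E) (v : Fin n → F), ∀ x, R x = ∑ i, inner ℂ (u i) x • v i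

lemma IsRankLE.of_fintype {κ : Type*} [Fintype κ] {r : ℕ} (hr : Fintype.card κ ≤ r)
    {R : E →L[ℂ] F} (u : κ → E) (v : κ → F) (h : ∀ x, R x = ∑ i, inner ℂ (u i) x • v i) :
    IsRankLE r R := by
  refine ⟨_, hr, u ∘ (Fintype.equivFin κ).symm, v ∘ (Fintype.equivFin κ).symm, fun x => ?_⟩
  rw [h x, ← (Fintype.equivFin κ).symm.sum_comp]
  rfl

lemma IsRankLE.add {r s : ℕ} {R S : E →L[ℂ] F} (hR : IsRankLE r R) (hS : IsRankLE s S) :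
    IsRankLE (r + s) (R + S) := by
  obtain ⟨n, hn, u, v, h⟩ := hR
  obtain ⟨k, hk, u', v', h'⟩ := hS
  refine ⟨n + k, by omega, Fin.append u u', Fin.append v v', fun x => ?_⟩
  simp [Fin.sum_univ_add, h, h']

lemma IsRankLE.comp_left {r : ℕ} {R : E →L[ℂ] F} (hR : IsRankLE r R) (A : F →L[ℂ] K) :
    IsRankLE r (A ∘L R) := by
  obtain ⟨n, hn, u, v, h⟩ := hR
  exact ⟨n, hn, u, fun i => A (v i), fun x => by simp [h]⟩

lemma IsRankLE.adjoint [CompleteSpace E] [CompleteSpace F] {r : ℕ} {R : E →L[ℂ] F}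
    (hR : IsRankLE r R) : IsRankLE r (ContinuousLinearMap.adjoint R) := by
  obtain ⟨n, hn, u, v, h⟩ := hR
  refine ⟨n, hn, v, u, fun y => ext_inner_left ℂ fun x => ?_⟩
  rw [ContinuousLinearMap.adjoint_inner_right, h, sum_inner, inner_sum]
  refine Finset.sum_congr rfl fun i _ => ?_
  rw [inner_smul_left, inner_smul_right, inner_conj_symm, mul_comm]

lemma IsRankLE.isCompactOperator {r : ℕ} {R : E →L[ℂ] F} (hR : IsRankLE r R) :
    IsCompactOperator R := by
  obtain ⟨n, -, u, v, h⟩ := hR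
  have hcomp : R = (∑ i, (ContinuousLinearMap.proj i : (Fin n → ℂ) →L[ℂ] ℂ).smulRight (v i)) ∘L
      ContinuousLinearMap.pi fun i => innerSL ℂ (u i) := by
    ext x
    simp [h]
  rw [hcomp]
  exact (isCompactOperator_of_locallyCompactSpace_dom
    (ContinuousLinearMap.pi fun i => innerSL ℂ (u i))).clm_comp _

/-- A finite orthonormal expansion has the Euclidean norm of its coefficients. -/
lemma norm_sq_sum_smul {κ : Type*} {σ : κ → F} (hσ : Orthonormal ℂ σ) (c : κ → ℂ)
    (A : Finset κ) : ‖∑ k ∈ A, c k • σ k‖ ^ 2 = ∑ k ∈ A, ‖c k‖ ^ 2 := by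
  have h := hσ.inner_sum c c A
  rw [inner_self_eq_norm_sq_to_K] at h
  have h2 : ∀ k, (starRingEnd ℂ) (c k) * c k = ((‖c k‖ ^ 2 : ℝ) : ℂ) := fun k => by
    rw [mul_comm, Complex.mul_conj, Complex.normSq_eq_norm_sq]
  simp only [h2] at h
  rw [← Complex.ofReal_sum] at h
  exact Complex.ofReal_injective (by push_cast at h ⊢; exact h)

/-- If `R` has rank at most `r` then `T` can expand by more than `‖T - R‖` on at most `r` vectors
of an orthonormal family that it maps to an orthogonal one. -/
lemma card_le_of_norm_sub_le {κ : Type*} {T R : E →L[ℂ] F} {r : ℕ} (hR : IsRankLE r R) {ε : ℝ}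
    (hε : ‖T - R‖ ≤ ε) {s : κ → ℝ} {e : κ → E} {σ : κ → F} (he : Orthonormal ℂ e)
    (hσ : Orthonormal ℂ σ) (hT : ∀ k, T (e k) = (s k : ℂ) • σ k) {A : Finset κ}
    (hA : ∀ k ∈ A, ε < s k) : A.card ≤ r := by
  obtain ⟨n, hn, u, v, h⟩ := hR
  by_contra! hlt
  let L : (A → ℂ) →ₗ[ℂ] (Fin n → ℂ) :=
    LinearMap.pi fun i => ∑ k : A, inner ℂ (u i) (e k) • LinearMap.proj k
  obtain ⟨c, hcL, hc0⟩ : ∃ c, L c = 0 ∧ c ≠ 0 := by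
    have := LinearMap.ker_ne_bot_of_finrank_lt (f := L) (by simpa using by omega)
    obtain ⟨c, hc, hc0⟩ := Submodule.exists_mem_ne_zero_of_ne_bot this
    exact ⟨c, hc, hc0⟩
  set x := ∑ k : A, c k • e k with hx
  have hu : ∀ i, inner ℂ (u i) x = 0 := fun i => by
    have := congrFun hcL i
    simp only [L, LinearMap.pi_apply, LinearMap.sum_apply, LinearMap.smul_apply,
      LinearMap.proj_apply, smul_eq_mul, Pi.zero_apply] at this
    rw [hx, inner_sum, ← this]
    refine Finset.sum_congr rfl fun k _ => ?_
    rw [inner_smul_right, mul_comm]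
  have hRx : R x = 0 := by simp [h, hu]
  have hε0 : 0 ≤ ε := (norm_nonneg _).trans hε
  have hTx : T x = ∑ k : A, (c k * s k) • σ k := by
    simp [hx, hT, mul_smul]
  have hnx : ‖x‖ ^ 2 = ∑ k : A, ‖c k‖ ^ 2 :=
    norm_sq_sum_smul (he.comp _ Subtype.val_injective) c Finset.univ
  have hnTx : ‖T x‖ ^ 2 = ∑ k : A, ‖c k * s k‖ ^ 2 := by
    rw [hTx]
    exact norm_sq_sum_smul (hσ.comp _ Subtype.val_injective) (fun k : A => c k * s k) Finset.univ
  have hle : ‖T x‖ ≤ ε * ‖x‖ := by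
    have := (T - R).le_of_opNorm_le hε x
    simpa [hRx] using this
  have h1 : ‖T x‖ ^ 2 ≤ ε ^ 2 * ‖x‖ ^ 2 := by
    rw [← mul_pow]
    gcongr
  rw [hnx, hnTx, Finset.mul_sum] at h1
  refine absurd h1 (not_le.2 (Finset.sum_lt_sum (fun k _ => ?_) ?_))
  · have := hA k k.2
    rw [norm_mul, mul_pow, mul_comm, Complex.norm_real, Real.norm_eq_abs, sq_abs]
    gcongr
  · obtain ⟨k, hk⟩ := Function.ne_iff.1 hc0
    refine ⟨k, Finset.mem_univ k, ?_⟩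
    have := hA k k.2
    rw [norm_mul, mul_pow, mul_comm, Complex.norm_real, Real.norm_eq_abs, sq_abs]
    have : 0 < ‖c k‖ := norm_pos_iff.2 hk
    gcongr

end FiniteRank

/-! ### Dyadic approximability and its equivalence with the Schatten class -/

section Approximation

variable {E F K : Type*} [NormedAddCommGroup E] [InnerProductSpace ℂ E]
  [NormedAddCommGroup F] [InnerProductSpace ℂ F] [NormedAddCommGroup K] [InnerProductSpace ℂ K]

/-- `T` lies within `2^{-j}` of an operator of rank at most `r j`, where
`∑ j, r j 2^{-jp} < ∞`. For operators between Hilbert spaces this characterizes the Schatten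
`p`-class, see `isSchattenClass_iff`. -/
def IsDyadicallyApproximable (p : ℝ) (T : E →L[ℂ] F) : Prop :=
  ∃ r : ℕ → ℕ, (Summable fun j => (r j : ℝ) * ((1 / 2 : ℝ) ^ p) ^ j) ∧
    ∀ j, ∃ R : E →L[ℂ] F, IsRankLE (r j) R ∧ ‖T - R‖ ≤ (1 / 2 : ℝ) ^ j

variable {p : ℝ} {T S : E →L[ℂ] F}

lemma summable_shift {r : ℕ → ℕ} (hr : Summable fun j => (r j : ℝ) * ((1 / 2 : ℝ) ^ p) ^ j)
    (k : ℕ) : Summable fun j => (r (j + k) : ℝ) * ((1 / 2 : ℝ) ^ p) ^ j := by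
  have h := ((summable_nat_add_iff k).2 hr).mul_right ((((1 / 2 : ℝ) ^ p) ^ k)⁻¹)
  refine h.congr fun j => ?_
  have : ((1 / 2 : ℝ) ^ p) ^ k ≠ 0 := (pow_pos half_rpow_pos k).ne'
  rw [pow_add]
  field_simp

lemma IsDyadicallyApproximable.zero : IsDyadicallyApproximable p (0 : E →L[ℂ] F) :=
  ⟨0, by simp, fun j =>
    ⟨0, ⟨0, le_rfl, Fin.elim0, Fin.elim0, by simp⟩, by simp⟩⟩

lemma IsDyadicallyApproximable.add (hT : IsDyadicallyApproximable p T)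
    (hS : IsDyadicallyApproximable p S) : IsDyadicallyApproximable p (T + S) := by
  obtain ⟨r, hr, h⟩ := hT
  obtain ⟨r', hr', h'⟩ := hS
  -- One level deeper, each error is at most half of `2^{-j}`.
  refine ⟨fun j => r (j + 1) + r' (j + 1), ?_, fun j => ?_⟩
  · refine ((summable_shift hr 1).add (summable_shift hr' 1)).congr fun j => ?_
    push_cast
    ring
  · obtain ⟨R, hR, hTR⟩ := h (j + 1)
    obtain ⟨R', hR', hSR⟩ := h' (j + 1)
    refine ⟨R + R', hR.add hR', ?_⟩
    calc ‖T + S - (R + R')‖ = ‖(T - R) + (S - R')‖ := by congr 1; abel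
      _ ≤ (1 / 2 : ℝ) ^ (j + 1) + (1 / 2 : ℝ) ^ (j + 1) :=
        (norm_add_le _ _).trans (add_le_add hTR hSR)
      _ = (1 / 2 : ℝ) ^ j := by ring

lemma IsDyadicallyApproximable.comp_left (hT : IsDyadicallyApproximable p T) (A : F →L[ℂ] K) :
    IsDyadicallyApproximable p (A ∘L T) := by
  obtain ⟨r, hr, h⟩ := hT
  -- Going `k` levels deeper absorbs the factor `‖A‖ < 2^k`.
  obtain ⟨k, hk⟩ := pow_unbounded_of_one_lt ‖A‖ (one_lt_two : (1 : ℝ) < 2)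
  refine ⟨fun j => r (j + k), summable_shift hr k, fun j => ?_⟩
  obtain ⟨R, hR, hTR⟩ := h (j + k)
  refine ⟨A ∘L R, hR.comp_left A, ?_⟩
  rw [← ContinuousLinearMap.comp_sub]
  calc ‖A ∘L (T - R)‖ ≤ 2 ^ k * (1 / 2 : ℝ) ^ (j + k) :=
        (A.opNorm_comp_le _).trans (mul_le_mul hk.le hTR (norm_nonneg _) (by positivity))
    _ = (1 / 2 : ℝ) ^ j * (2 * (1 / 2)) ^ k := by rw [pow_add, mul_pow]; ring
    _ = (1 / 2 : ℝ) ^ j := by norm_num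

lemma IsDyadicallyApproximable.adjoint [CompleteSpace E] [CompleteSpace F]
    (hT : IsDyadicallyApproximable p T) :
    IsDyadicallyApproximable p (ContinuousLinearMap.adjoint T) := by
  obtain ⟨r, hr, h⟩ := hT
  refine ⟨r, hr, fun j => ?_⟩
  obtain ⟨R, hR, hTR⟩ := h j
  refine ⟨ContinuousLinearMap.adjoint R, hR.adjoint, ?_⟩
  rwa [← map_sub, LinearIsometryEquiv.norm_map]

lemma IsDyadicallyApproximable.comp_right [CompleteSpace E] [CompleteSpace F] [CompleteSpace K]
    (hT : IsDyadicallyApproximable p T) (A : K →L[ℂ] E) :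
    IsDyadicallyApproximable p (T ∘L A) := by
  have h := (hT.adjoint.comp_left (ContinuousLinearMap.adjoint A)).adjoint
  rwa [ContinuousLinearMap.adjoint_comp, ContinuousLinearMap.adjoint_adjoint,
    ContinuousLinearMap.adjoint_adjoint] at h

lemma IsDyadicallyApproximable.neg (hT : IsDyadicallyApproximable p T) :
    IsDyadicallyApproximable p (-T) := by
  have h := hT.comp_left (-ContinuousLinearMap.id ℂ F)
  rwa [ContinuousLinearMap.neg_comp, ContinuousLinearMap.id_comp] at h

lemma IsDyadicallyApproximable.isCompactOperator [CompleteSpace F]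
    (hT : IsDyadicallyApproximable p T) : IsCompactOperator T := by
  obtain ⟨r, -, h⟩ := hT
  choose R hR hTR using h
  refine isCompactOperator_of_tendsto (l := atTop) (F := R) ?_
    (Eventually.of_forall fun j => (hR j).isCompactOperator)
  rw [tendsto_iff_norm_sub_tendsto_zero]
  refine squeeze_zero (fun _ => norm_nonneg _) (fun j => ?_)
    (tendsto_pow_atTop_nhds_zero_of_lt_one (by norm_num : (0 : ℝ) ≤ 1 / 2) (by norm_num))
  rw [norm_sub_rev]
  exact hTR j

/-- If `T` is dyadically approximable and maps an orthonormal family to multiples of another one,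
then the level sets of the factors are counted by the approximating ranks. -/
lemma IsDyadicallyApproximable.layers (hT : IsDyadicallyApproximable p T) {κ : Type*}
    {s : κ → ℝ} {e : κ → E} {σ : κ → F} (he : Orthonormal ℂ e) (hσ : Orthonormal ℂ σ)
    (hTe : ∀ k, T (e k) = (s k : ℂ) • σ k) :
    (∀ j : ℕ, {k | (1 / 2 : ℝ) ^ j < s k}.Finite) ∧
    Summable fun j : ℕ => ({k | (1 / 2 : ℝ) ^ j < s k}.ncard : ℝ) * ((1 / 2 : ℝ) ^ p) ^ j := by
  obtain ⟨r, hr, h⟩ := hT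
  have hcard : ∀ (j : ℕ) (A : Finset κ), (∀ k ∈ A, (1 / 2 : ℝ) ^ j < s k) → A.card ≤ r j := by
    intro j A hA
    obtain ⟨R, hR, hTR⟩ := h j
    exact card_le_of_norm_sub_le hR hTR he hσ hTe hA
  have hfin : ∀ j : ℕ, {k | (1 / 2 : ℝ) ^ j < s k}.Finite := by
    intro j
    by_contra hinf
    obtain ⟨A, hA, hAc⟩ := Set.Infinite.exists_subset_card_eq hinf (r j + 1)
    have := hcard j A fun k hk => hA hk
    omega
  refine ⟨hfin, .of_nonneg_of_le (fun j => by positivity) (fun j => ?_) hr⟩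
  gcongr
  rw [Set.ncard_eq_toFinset_card _ (hfin j)]
  exact hcard j _ fun k hk => by simpa using hk

/-- Comparison of an orthogonal expansion with Fourier coefficients. -/
lemma norm_le_of_hasSum {κ : Type*} {e : κ → E} {σ : κ → F} (he : Orthonormal ℂ e)
    (hσ : Orthonormal ℂ σ) {c : κ → ℂ} {x : E} {y : F} {ε : ℝ} (hε : 0 ≤ ε)
    (hy : HasSum (fun k => c k • σ k) y) (hc : ∀ k, ‖c k‖ ≤ ε * ‖inner ℂ (e k) x‖) :
    ‖y‖ ≤ ε * ‖x‖ := by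
  refine le_of_tendsto hy.norm (Eventually.of_forall fun A => ?_)
  refine le_of_sq_le_sq ?_ (by positivity)
  rw [norm_sq_sum_smul hσ, mul_pow]
  calc ∑ k ∈ A, ‖c k‖ ^ 2 ≤ ∑ k ∈ A, ε ^ 2 * ‖inner ℂ (e k) x‖ ^ 2 := by
        refine Finset.sum_le_sum fun k _ => ?_
        rw [← mul_pow]
        exact pow_le_pow_left₀ (norm_nonneg _) (hc k) 2
    _ ≤ ε ^ 2 * ‖x‖ ^ 2 := by
        rw [← Finset.mul_sum]
        exact mul_le_mul_of_nonneg_left (he.sum_inner_products_le x) (by positivity)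

/-- Truncation: keep the terms with `s n > 2^{-j}`, whose number bounds the rank. The remaining
coefficients are at most `2^{-j}`, and by Bessel so is the norm of the remainder. -/
lemma IsSingularValueDecomposition.isDyadicallyApproximable {N : Set ℕ} {s : N → ℝ} {e : N → E}
    {σ : N → F} (h : IsSingularValueDecomposition T N s e σ) (hp : 0 < p)
    (hs : Summable fun n => s n ^ p) : IsDyadicallyApproximable p T := by
  classical
  have hfin := finite_layer_of_summable hp hs
  refine ⟨_, summable_ncard_layer hp (fun n => (h.pos n).le) hs, fun j => ?_⟩
  let A := (hfin j).toFinset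
  refine ⟨∑ k ∈ A, (innerSL ℂ (e k)).smulRight ((s k : ℂ) • σ k), ?_, ?_⟩
  · refine IsRankLE.of_fintype (κ := A) ?_ (fun k => e k) (fun k => (s k : ℂ) • σ k) fun x => ?_
    · rw [Fintype.card_coe, Set.ncard_eq_toFinset_card _ (hfin j)]
    · simp only [_root_.sum_apply, ContinuousLinearMap.smulRight_apply,
        innerSL_apply_apply]
      exact (Finset.sum_coe_sort A fun k => inner ℂ (e k) x • (s k : ℂ) • σ k).symm
  · refine ContinuousLinearMap.opNorm_le_bound _ (by positivity) fun x => ?_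
    refine norm_le_of_hasSum h.orthonormal_left h.orthonormal_right (by positivity)
      (c := fun k => if k ∈ A then 0 else (s k : ℂ) * inner ℂ (e k) x) ?_ fun k => ?_
    · have h1 := h.hasSum x
      have h2 : HasSum (fun k => if k ∈ A then ((s k : ℂ) * inner ℂ (e k) x) • σ k else 0)
          (∑ k ∈ A, ((s k : ℂ) * inner ℂ (e k) x) • σ k) := by
        have := hasSum_sum_of_ne_finset_zero (s := A) (L := .unconditional _)
          (f := fun k => if k ∈ A then ((s k : ℂ) * inner ℂ (e k) x) • σ k else 0)
          fun k hk => if_neg hk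
        rwa [Finset.sum_congr rfl fun k hk => if_pos hk] at this
      convert h1.sub h2 using 1
      · funext k
        split_ifs <;> simp
      · simp only [_root_.sub_apply, _root_.sum_apply,
          ContinuousLinearMap.smulRight_apply, innerSL_apply_apply, smul_smul]
        simp only [mul_comm]
    · split_ifs with hk
      · simp only [norm_zero]
        positivity
      · have : s k ≤ (1 / 2 : ℝ) ^ j := by simpa [A] using hk
        rw [norm_mul, Complex.norm_real, Real.norm_of_nonneg (h.pos k).le]
        gcongr

/-- A compact self-adjoint operator has a Hilbert basis of eigenvectors. -/
lemma exists_hilbertBasis_eigenvectors.{u} {E : Type u} [NormedAddCommGroup E]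
    [InnerProductSpace ℂ E] [CompleteSpace E] {A : E →L[ℂ] E}
    (hA : IsCompactOperator A) (hA' : A.IsSymmetric) :
    ∃ (κ : Type u) (b : HilbertBasis κ ℂ E) (μ : κ → ℂ), ∀ k, A (b k) = μ k • b k := by
  have hclosed : ∀ μ : ℂ, CompleteSpace (Module.End.eigenspace (A : Module.End ℂ E) μ) := by
    intro μ
    refine IsClosed.completeSpace_coe (hs := ?_)
    have : (Module.End.eigenspace (A : Module.End ℂ E) μ : Set E) = {x | A x = μ • x} := by
      ext x
      simp
    rw [this]
    exact isClosed_eq A.continuous (continuous_const_smul μ)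
  choose w b _ using fun μ : ℂ =>
    exists_hilbertBasis ℂ (Module.End.eigenspace (A : Module.End ℂ E) μ)
  have hfam := LinearMap.IsSymmetric.orthogonalFamily_eigenspaces hA'
  have hon := hfam.orthonormal_sigma_orthonormal fun μ => (b μ).orthonormal
  refine ⟨Σ μ : ℂ, w μ, HilbertBasis.mkOfOrthogonalEqBot hon ?_, Sigma.fst, fun k => ?_⟩
  -- By the spectral theorem only zero is orthogonal to all eigenspaces. A vector orthogonal to
  -- every `b μ k` is such a vector: expand an eigenvector `y` in the basis `b μ`.
  · rw [eq_bot_iff, ← ContinuousLinearMap.orthogonalComplement_iSup_eigenspaces_eq_bot hA hA',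
      ← Submodule.iInf_orthogonal, le_iInf_iff]
    intro μ x hx y hy
    have h := (((b μ).hasSum_repr ⟨y, hy⟩).mapL (Submodule.subtypeL _)).mapL (innerSL ℂ x)
    have h0 : ∀ k, innerSL ℂ x (Submodule.subtypeL _ ((b μ).repr ⟨y, hy⟩ k • b μ k)) = 0 := by
      intro k
      have := (Submodule.mem_orthogonal' _ _).1 hx _ (Submodule.subset_span ⟨⟨μ, k⟩, rfl⟩)
      rw [map_smul, map_smul, smul_eq_mul]
      exact mul_eq_zero_of_right _ this
    simp only [h0] at h
    exact inner_eq_zero_symm.1 (h.unique hasSum_zero)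
  · rw [HilbertBasis.coe_mkOfOrthogonalEqBot]
    exact Module.End.mem_eigenspace_iff.1 (b k.1 k.2).2

/-- An orthonormal expansion of an approximable operator, over any index type, is a singular value
decomposition with `p`-summable singular values. -/
lemma IsDyadicallyApproximable.exists_of_expansion (hp : 0 < p)
    (hT : IsDyadicallyApproximable p T) {κ : Type*} {s : κ → ℝ} {e : κ → E} {σ : κ → F}
    (he : Orthonormal ℂ e) (hσ : Orthonormal ℂ σ) (hs : ∀ k, 0 < s k)
    (hTe : ∀ k, T (e k) = (s k : ℂ) • σ k)
    (hexp : ∀ x, HasSum (fun k => ((s k : ℂ) * inner ℂ (e k) x) • σ k) (T x)) :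
    ∃ (N : Set ℕ) (s : N → ℝ) (e : N → E) (σ : N → F),
      IsSingularValueDecomposition T N s e σ ∧ Summable (fun n => s n ^ p) := by
  obtain ⟨hfin, hlayers⟩ := hT.layers he hσ hTe
  have hbound : ∀ k, s k ≤ ‖T‖ := fun k => by
    have h := T.le_opNorm (e k)
    rw [hTe, norm_smul, hσ.norm_eq_one, he.norm_eq_one, mul_one, mul_one, Complex.norm_real] at h
    exact (le_abs_self _).trans h
  have hsum : Summable fun k => s k ^ p :=
    summable_rpow_of_summable_ncard_layer hp (fun k => (hs k).le) hbound hfin hlayers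
  -- Every `k` lies in one of the countably many finite level sets.
  have : Countable κ := by
    rw [← Set.countable_univ_iff]
    refine (Set.countable_iUnion fun j => (hfin j).countable).mono fun k _ => ?_
    obtain ⟨j, hj, -⟩ := exists_first_layer (hs k)
    exact Set.mem_iUnion.2 ⟨j, hj⟩
  obtain ⟨f, hf⟩ := Countable.exists_injective_nat κ
  let φ := (Equiv.ofInjective f hf).symm
  exact ⟨Set.range f, s ∘ φ, e ∘ φ, σ ∘ φ,
    ⟨he.comp _ φ.injective, hσ.comp _ φ.injective, fun n => hs _,
      fun x => φ.hasSum_iff.2 (hexp x)⟩, φ.summable_iff.2 hsum⟩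

/-- A Hilbert basis mapped to an orthogonal family yields a singular value decomposition of an
approximable operator. -/
lemma IsDyadicallyApproximable.exists_of_hilbertBasis (hp : 0 < p)
    (hT : IsDyadicallyApproximable p T) {κ : Type*} (b : HilbertBasis κ ℂ E)
    (horth : ∀ k l, k ≠ l → inner ℂ (T (b k)) (T (b l)) = 0) :
    ∃ (N : Set ℕ) (s : N → ℝ) (e : N → E) (σ : N → F),
      IsSingularValueDecomposition T N s e σ ∧ Summable (fun n => s n ^ p) := by
  have hs : ∀ k : {k // T (b k) ≠ 0}, 0 < ‖T (b k)‖ := fun k => norm_pos_iff.2 k.2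
  have hTe : ∀ k : {k // T (b k) ≠ 0},
      T (b k) = (‖T (b k)‖ : ℂ) • ((‖T (b k)‖⁻¹ : ℝ) : ℂ) • T (b k) := fun k => by
    rw [smul_smul, ← Complex.ofReal_mul, mul_inv_cancel₀ (hs k).ne', Complex.ofReal_one, one_smul]
  refine hT.exists_of_expansion hp (κ := {k // T (b k) ≠ 0}) (s := fun k => ‖T (b k)‖)
    (e := fun k => b k) (σ := fun k => ((‖T (b k)‖⁻¹ : ℝ) : ℂ) • T (b k))
    (b.orthonormal.comp _ Subtype.val_injective) ⟨fun k => ?_, fun k l hkl => ?_⟩ hs hTe fun x => ?_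
  · rw [norm_smul, Complex.norm_real, norm_inv, norm_norm]
    exact inv_mul_cancel₀ (hs k).ne'
  · beta_reduce
    rw [inner_smul_left, inner_smul_right, horth _ _ (fun h => hkl (Subtype.ext h)), mul_zero,
      mul_zero]
  · have h := (b.hasSum_repr x).mapL T
    rw [← Function.Injective.hasSum_iff (Subtype.val_injective (p := fun k => T (b k) ≠ 0))] at h
    · refine h.congr_fun fun k => ?_
      rw [Function.comp_apply, map_smul, mul_comm, mul_smul, ← hTe, b.repr_apply_apply]
    · intro k hk
      have : T (b k) = 0 := by simpa using hk
      rw [map_smul, this, smul_zero]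

/-- An approximable operator between Hilbert spaces has a singular value decomposition with
`p`-summable singular values. -/
lemma IsDyadicallyApproximable.exists_singularValueDecomposition [CompleteSpace E]
    [CompleteSpace F] (hp : 0 < p) (hT : IsDyadicallyApproximable p T) :
    ∃ (N : Set ℕ) (s : N → ℝ) (e : N → E) (σ : N → F),
      IsSingularValueDecomposition T N s e σ ∧ Summable (fun n => s n ^ p) := by
  obtain ⟨κ, b, μ, hb⟩ := exists_hilbertBasis_eigenvectors
    (hT.isCompactOperator.clm_comp (ContinuousLinearMap.adjoint T))
    (A := ContinuousLinearMap.adjoint T ∘L T)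
    (ContinuousLinearMap.isPositive_adjoint_comp_self T).isSymmetric
  refine hT.exists_of_hilbertBasis hp b fun k l hkl => ?_
  -- `⟨T b_k, T b_l⟩ = ⟨b_k, T* T b_l⟩ = μ_l ⟨b_k, b_l⟩ = 0`.
  rw [← ContinuousLinearMap.adjoint_inner_right, ← ContinuousLinearMap.comp_apply, hb,
    inner_smul_right, b.orthonormal.inner_eq_zero hkl, mul_zero]

theorem isSchattenClass_iff [CompleteSpace E] [CompleteSpace F] (hp : 0 < p) :
    IsSchattenClass p T ↔ IsDyadicallyApproximable p T :=
  ⟨fun ⟨_, _, _, _, _, h, hs⟩ => h.isDyadicallyApproximable hp hs,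
    fun h => ⟨h.isCompactOperator, h.exists_singularValueDecomposition hp⟩⟩

end Approximation

/-! ### Diagonal and synthesis operators, and the ideal -/

section Main

variable {ι : Type*} {H : Type*} [NormedAddCommGroup H] [InnerProductSpace ℂ H]
  {G : ι → Type*} [∀ i, NormedAddCommGroup (G i)]

lemma memℓp_two_iff {f : ∀ i, G i} : Memℓp f 2 ↔ Summable fun i => ‖f i‖ ^ 2 := by
  rw [memℓp_gen_iff (by norm_num)]
  norm_num

lemma lp_norm_sq_eq_tsum (f : lp G 2) : ‖f‖ ^ 2 = ∑' i, ‖f i‖ ^ 2 := by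
  have h := lp.norm_rpow_eq_tsum (by norm_num) f
  norm_num at h
  exact h

variable [∀ i, InnerProductSpace ℂ (G i)]

/-- A bounded symbol defines a bounded diagonal operator. -/
lemma exists_diagonalOperator {m : ι → ℂ} {c : ℝ} (hc : 0 ≤ c) (hm : ∀ i, ‖m i‖ ≤ c) :
    ∃ D : lp G 2 →L[ℂ] lp G 2, IsDiagonalOperator m D ∧ ‖D‖ ≤ c := by
  have hterm : ∀ (ξ : lp G 2) i, ‖m i • ξ i‖ ^ 2 ≤ c ^ 2 * ‖ξ i‖ ^ 2 := fun ξ i => by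
    rw [norm_smul, mul_pow]
    have := hm i
    gcongr
  have hsum : ∀ ξ : lp G 2, Summable fun i => c ^ 2 * ‖ξ i‖ ^ 2 := fun ξ =>
    (memℓp_two_iff.1 (lp.memℓp ξ)).mul_left _
  have hsum' : ∀ ξ : lp G 2, Summable fun i => ‖m i • ξ i‖ ^ 2 := fun ξ =>
    .of_nonneg_of_le (fun _ => by positivity) (hterm ξ) (hsum ξ)
  let L : lp G 2 →ₗ[ℂ] lp G 2 :=
    { toFun := fun ξ => ⟨fun i => m i • ξ i, memℓp_two_iff.2 (hsum' ξ)⟩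
      map_add' := fun ξ η => by
        ext i
        exact smul_add _ _ _
      map_smul' := fun a ξ => by
        ext i
        exact smul_comm _ _ _ }
  refine ⟨L.mkContinuous c fun ξ => ?_, fun ξ i => rfl, L.mkContinuous_norm_le hc _⟩
  refine le_of_sq_le_sq ?_ (by positivity)
  rw [lp_norm_sq_eq_tsum, mul_pow, lp_norm_sq_eq_tsum, ← tsum_mul_left]
  exact (hsum' ξ).tsum_le_tsum (hterm ξ) (hsum ξ)

/-- The diagonal operator with `p`-summable symbol is in the Schatten class if the dimensions of
the blocks are bounded. -/
lemma IsDiagonalOperator.isDyadicallyApproximable {p : ℝ} (hp : 0 < p) {m : ι → ℂ}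
    (hm : Summable fun i => ‖m i‖ ^ p) {d : ℕ} (hdim : ∀ i, Module.rank ℂ (G i) ≤ d)
    {D : lp G 2 →L[ℂ] lp G 2} (hD : IsDiagonalOperator m D) :
    IsDyadicallyApproximable p D := by
  classical
  have hfin := finite_layer_of_summable hp hm
  have hfd : ∀ i, FiniteDimensional ℂ (G i) := fun i =>
    Module.rank_lt_aleph0_iff.1 ((hdim i).trans_lt Cardinal.natCast_lt_aleph0)
  refine ⟨fun j => d * {i | (1 / 2 : ℝ) ^ j < ‖m i‖}.ncard, ?_, fun j => ?_⟩
  · refine ((summable_ncard_layer hp (fun i => norm_nonneg (m i)) hm).mul_left (d : ℝ)).congr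
      fun j => ?_
    push_cast
    ring
  let A := (hfin j).toFinset
  -- `Q` is the tail with symbol at most `2^{-j}`; the approximant `D - Q` lives on the finitely
  -- many blocks in `A`, each of dimension at most `d`.
  obtain ⟨Q, hQ, hQn⟩ := exists_diagonalOperator (G := G)
    (m := fun i => if i ∈ A then 0 else m i) (c := (1 / 2 : ℝ) ^ j) (by positivity) fun i => by
      split_ifs with hi
      · rw [norm_zero]
        positivity
      · simpa [A] using hi
  refine ⟨D - Q, ?_, by rwa [sub_sub_cancel]⟩
  let b := fun i => stdOrthonormalBasis ℂ (G i)
  refine IsRankLE.of_fintype (κ := Σ i : A, Fin (Module.finrank ℂ (G i))) ?_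
    (fun k => lp.single 2 k.1.1 (b k.1 k.2)) (fun k => m k.1 • lp.single 2 k.1.1 (b k.1 k.2))
    fun ξ => ?_
  · rw [Fintype.card_sigma]
    simp only [Fintype.card_fin]
    refine (Finset.sum_le_card_nsmul _ _ d fun i _ => ?_).trans (le_of_eq ?_)
    · exact Module.finrank_le_of_rank_le (hdim i)
    · rw [Finset.card_univ, Fintype.card_coe, Set.ncard_eq_toFinset_card _ (hfin j), smul_eq_mul,
        mul_comm]
  · have hrow : ∀ i : ι, ∑ k, inner ℂ (lp.single 2 i (b i k)) ξ • m i • lp.single 2 i (b i k) =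
        lp.single 2 i (m i • ξ i) := fun i => by
      conv_rhs => rw [← (b i).sum_repr' (ξ i), Finset.smul_sum]
      change _ = lp.singleContinuousLinearMap ℂ G 2 i _
      rw [map_sum]
      refine Finset.sum_congr rfl fun k _ => ?_
      rw [lp.inner_single_left, map_smul, map_smul, smul_comm]
      rfl
    refine Eq.trans ?_ ((Fintype.sum_sigma _).trans ((Fintype.sum_congr _ _ fun i : A => hrow i).trans
      (Finset.sum_coe_sort A fun i => lp.single 2 i (m i • ξ i)))).symm
    ext i
    rw [_root_.sub_apply, lp.coeFn_sub, Pi.sub_apply, hD, hQ, lp.coeFn_sum, Finset.sum_apply]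
    simp only [lp.single_apply, Finset.sum_pi_single]
    split_ifs <;> simp

variable [CompleteSpace H] [∀ i, CompleteSpace (G i)]

/-- The synthesis operator of a `g`-Bessel sequence is bounded, and its adjoint is the analysis
operator. -/
lemma IsGBessel.exists_synthesisOperator {Λ : ∀ i, H →L[ℂ] G i} (hΛ : IsGBessel Λ) :
    ∃ T : lp G 2 →L[ℂ] H, IsSynthesisOperator Λ T ∧
      ∀ f i, ContinuousLinearMap.adjoint T f i = Λ i f := by
  classical
  obtain ⟨B, hB⟩ := hΛ
  let L : H →ₗ[ℂ] lp G 2 :=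
    { toFun := fun f => ⟨fun i => Λ i f, memℓp_two_iff.2 (hB f).1⟩
      map_add' := fun f g => by
        ext i
        exact map_add _ _ _
      map_smul' := fun a f => by
        ext i
        exact map_smul _ _ _ }
  -- `U` is the analysis operator; the synthesis operator is defined as its adjoint. `max B 0` is
  -- used because `B` may be negative when `H` is trivial.
  let U : H →L[ℂ] lp G 2 := L.mkContinuous (√(max B 0)) fun f => by
    refine le_of_sq_le_sq ?_ (by positivity)
    rw [lp_norm_sq_eq_tsum, mul_pow, Real.sq_sqrt (le_max_right _ _)]
    exact (hB f).2.trans (mul_le_mul_of_nonneg_right (le_max_left _ _) (by positivity))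
  have hU : ∀ f i, U f i = Λ i f := fun _ _ => rfl
  refine ⟨ContinuousLinearMap.adjoint U, fun ξ => ?_, fun f i => by
    rw [ContinuousLinearMap.adjoint_adjoint, hU]⟩
  refine ((lp.hasSum_single (by norm_num) ξ).mapL (ContinuousLinearMap.adjoint U)).congr_fun
    fun i => ext_inner_left ℂ fun f => ?_
  rw [ContinuousLinearMap.adjoint_inner_right, ContinuousLinearMap.adjoint_inner_right,
    lp.inner_single_right, hU]

/-- The Schatten `p`-class as a two-sided ideal, closed under adjoints. -/
theorem exists_schattenIdeal {p : ℝ} (hp : 0 < p) :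
    ∃ S : TwoSidedIdeal (H →L[ℂ] H), (∀ T, T ∈ S ↔ IsSchattenClass p T) ∧
      ∀ T ∈ S, ContinuousLinearMap.adjoint T ∈ S := by
  let S : TwoSidedIdeal (H →L[ℂ] H) := .mk' {T | IsDyadicallyApproximable p T}
    IsDyadicallyApproximable.zero IsDyadicallyApproximable.add IsDyadicallyApproximable.neg
    (fun {A _} hT => hT.comp_left A) (fun {_ A} hT => hT.comp_right A)
  have hS : ∀ T, T ∈ S ↔ IsDyadicallyApproximable p T := fun T => by
    simp only [S, TwoSidedIdeal.mem_mk', Set.mem_ofPred_eq]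
  exact ⟨S, fun T => (hS T).trans (isSchattenClass_iff hp).symm,
    fun T hT => (hS _).2 ((hS T).1 hT).adjoint⟩

end Main

end ControlledGFrame

theorem mainTheorem4 {ι : Type*} [Countable ι]
    {H : Type*} [NormedAddCommGroup H] [InnerProductSpace ℂ H] [CompleteSpace H]
    {G : ι → Type*} [∀ i, NormedAddCommGroup (G i)] [∀ i, InnerProductSpace ℂ (G i)]
    [∀ i, CompleteSpace (G i)]
    (C C' : H →L[ℂ] H)
    (hC : ControlledGFrame.IsInvertiblePositive C)
    (hC' : ControlledGFrame.IsInvertiblePositive C')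
    (Λ Θ : ∀ i, H →L[ℂ] G i)
    (hΛ : ControlledGFrame.IsControlledGBessel C' C' Λ)
    (hΘ : ControlledGFrame.IsControlledGBessel C C Θ)
    (p : ℝ) (hp : 0 < p)
    (m : ι → ℂ) (hm : Memℓp m (ENNReal.ofReal p))
    (hdim : ∃ d : ℕ, ∀ i, Module.rank ℂ (G i) ≤ d) :
    (∃ (M : H →L[ℂ] H) (TΘ TΛ : lp G 2 →L[ℂ] H) (D : lp G 2 →L[ℂ] lp G 2),
      ControlledGFrame.IsControlledMultiplier m C C' Θ Λ M ∧
      ControlledGFrame.IsSynthesisOperator Θ TΘ ∧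
      ControlledGFrame.IsSynthesisOperator Λ TΛ ∧
      ControlledGFrame.IsDiagonalOperator m D ∧
      M = C ∘L TΘ ∘L D ∘L ContinuousLinearMap.adjoint TΛ ∘L C' ∧
      ControlledGFrame.IsSchattenClass p D ∧
      ControlledGFrame.IsSchattenClass p M) ∧
    (∃ S : TwoSidedIdeal (H →L[ℂ] H),
      (∀ T, T ∈ S ↔ ControlledGFrame.IsSchattenClass p T) ∧
      (∀ T ∈ S, ContinuousLinearMap.adjoint T ∈ S)) := by
  refine ⟨?_, ControlledGFrame.exists_schattenIdeal hp⟩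
  obtain ⟨d, hd⟩ := hdim
  obtain ⟨TΘ, hTΘ, -⟩ := hΘ.1.exists_synthesisOperator
  obtain ⟨TΛ, hTΛ, hTΛ'⟩ := hΛ.1.exists_synthesisOperator
  -- `ℓ^p ⊆ ℓ^∞` bounds the symbol; `max c 0` covers an empty index set.
  obtain ⟨c, hc⟩ := (hm.of_exponent_ge le_top).bddAbove
  obtain ⟨D, hD, -⟩ := ControlledGFrame.exists_diagonalOperator (G := G) (m := m) 
    (le_max_right c 0) fun i => le_max_of_le_left (hc ⟨i, rfl⟩)
  have hms : Summable fun i => ‖m i‖ ^ p := by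
    have h := hm.summable (by rwa [ENNReal.toReal_ofReal hp.le])
    rwa [ENNReal.toReal_ofReal hp.le] at h
  have hDa := hD.isDyadicallyApproximable hp hms hd
  refine ⟨C ∘L TΘ ∘L D ∘L ContinuousLinearMap.adjoint TΛ ∘L C', TΘ, TΛ, D, fun f => ?_, hTΘ, hTΛ,
    hD, rfl, (ControlledGFrame.isSchattenClass_iff hp).2 hDa,
    (ControlledGFrame.isSchattenClass_iff hp).2 ?_⟩
  · refine ((hTΘ (D (ContinuousLinearMap.adjoint TΛ (C' f)))).mapL C).congr_fun fun i => ?_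
    rw [hD, hTΛ', map_smul, map_smul]
  · exact ((hDa.comp_right (ContinuousLinearMap.adjoint TΛ ∘L C')).comp_left TΘ).comp_left C
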